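/- Let $R$ be a commutative ring of characteristic zero (that is, $\mathbb{Z}\to R$ is injective; for instance $R=\mathbb{Z}$ or a field of characteristic $0$). For an integer $N\ge 1$ let $\mathrm{Circ}(x_0,\dots,x_{N-1})$ be the generic $N\times N$ circulant matrix over $R[x_0,\dots,x_{N-1}]$, whose entry in row $i$ and column $j$ ($0\le i,j\le N-1$) is $x_{(j-i)\bmod N}$. Let $d(N)$ (respectively $p(N)$) be the number of monomials with non-zero coefficient in the polynomial $\det\mathrm{Circ}(x_0,\dots,x_{N-1})$ (respectively $\mathrm{per}\,\mathrm{Circ}(x_0,\dots,x_{N-1})$), after like terms have been combined. Then $d(N)=p(N)$ if and only if $N=p^r$ for some prime number $p$ and some integer $r\ge 0$. -/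

import Mathlib

/-- The circulant matrix with first row `(v 0, v 1, …, v (N - 1))`: successive rows are cyclic shifts
to the right, so that the entry in row `i` and column `j` is `v (j - i)`, indices taken modulo `N`.
Mathlib's `Matrix.circulant v` has `v` as its first column, so this is its transpose. -/
def rowCirculant {α : Type*} {N : ℕ} (v : Fin N → α) : Matrix (Fin N) (Fin N) α :=
  (Matrix.circulant v).transpose

theorem rowCirculant_apply {α : Type*} {N : ℕ} (v : Fin N → α) (i j : Fin N) :
    rowCirculant v i j = v (j - i) := rfl

/-- The generic `N × N` circulant matrix, with first row the indeterminates `x_0, …, x_{N-1}`. -/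
noncomputable def genericCirculant (R : Type*) [CommRing R] (N : ℕ) :
    Matrix (Fin N) (Fin N) (MvPolynomial (Fin N) R) :=
  rowCirculant MvPolynomial.X

/-- `d(N)`: the number of monomials with nonzero coefficient in the determinant of the generic
`N × N` circulant matrix over `R`, after like terms have been combined. -/
noncomputable def numDetTerms (R : Type*) [CommRing R] (N : ℕ) : ℕ :=
  (genericCirculant R N).det.support.card

/-- `p(N)`: the number of monomials with nonzero coefficient in the permanent of the generic
`N × N` circulant matrix over `R`, after like terms have been combined. -/
noncomputable def numPermTerms (R : Type*) [CommRing R] (N : ℕ) : ℕ :=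
  (genericCirculant R N).permanent.support.card

/-!
Let `ζ` be a primitive `N`-th root of unity. The determinant of the generic circulant matrix is
`∏ x, ∑ c, ζ ^ (x * c) X_c` (`det_complex`), so, up to a nonzero factor, its coefficient at the
monomial `∏ i, X_{b i}` is `rootSum b`, the sum of `∏ i, ζ ^ (σ i * b i)` over all bijections `σ`
(`factorial_mul_coeff_det`). A monomial occurs in the permanent exactly when it comes from
`b i = σ i - i` for a permutation `σ`, and every monomial of the determinant occurs in the permanent;
hence the two numbers agree iff `rootSum b ≠ 0` for all these `b` (`card_support_det_eq_iff`).

Sums over injections obey a recursion that splits off the set of indices which are merged with a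
given one (`rootSum_insert`): a block of `s` indices contributes `(-1) ^ (s - 1) * (s - 1)! * N` if
its `b`-values add up to zero in `ℤ/N`, and nothing otherwise. Iterated, it writes `rootSum b` as
a sum over the partitions of the index set into zero-sum blocks.

If `N = p ^ r`, the partition with a single block contributes `± N!`, and `(p - 1) * v_p(N!) < N`.
By Legendre's formula a block of size `s < N` contributes a multiple of `p ^ v` with
`s ≤ (p - 1) * v`, so a partition into smaller blocks contributes a multiple of `p ^ v` with
`N ≤ (p - 1) * v`. Thus `± N!` cannot be cancelled (`rootSum_ne_zero`).

If `N` is not a prime power, the Chinese remainder theorem gives `0 < k < N - 1` with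
`k * (k + 1) = q * N`. Choose positive integers, `k + 1` in number and exactly `q` of them equal to
`1`, with sum `N + 1`, and let `b` take these values, the value `-1` once, and `0` otherwise. The only
proper zero-sum blocks of the nonzero values are `{1, -1}` and its complement, and the contributions
`(k + 1)! * N` and `q * N * (k - 1)! * N` cancel (`rootSum_eq_zero`). A suitable choice of the
integers makes `b` the difference sequence of a permutation (`circPerm`).
-/

open Finset MvPolynomial

/-! ### Sums over injections -/

section InjSum
variable {K X ι : Type*} [CommRing K] [DecidableEq X]

/-- One step of a sum over injections: choose a point `x` of `U`, weighted by `v x`, and pass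
`U` without `x` on to `g`. -/
def avoidSum (v : X → K) (g : Finset X → K) (U : Finset X) : K :=
  ∑ x ∈ U, v x * g (U.erase x)

/-- Two steps commute, so that the steps can be iterated over a finite set of indices. -/
instance avoidSum_leftCommutative (w : ι → X → K) :
    LeftCommutative fun i (g : Finset X → K) => avoidSum (w i) g where
  left_comm i j g := by
    funext U
    simp only [avoidSum, mul_sum]
    rw [Finset.sum_comm' (t' := U) (s' := fun y => U.erase y)]
    · refine sum_congr rfl fun y _ => sum_congr rfl fun x _ => ?_
      rw [erase_right_comm]
      ring
    · intro x y
      simp only [mem_erase]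
      tauto

/-- The sum of `∏ i ∈ T, w i (f i)` over the injections `f : T → U`. It is built index by index, which
keeps all sums over `Finset X`; `injSum_fin` and `injSum_univ_eq_sum_perm` recover the description by
injective functions. -/
def injSum (w : ι → X → K) (T : Finset ι) (U : Finset X) : K :=
  Multiset.foldr (fun i g => avoidSum (w i) g) (fun _ => 1) T.val U

theorem injSum_empty (w : ι → X → K) (U : Finset X) : injSum w ∅ U = 1 := by
  simp [injSum]

variable [DecidableEq ι]

theorem injSum_insert (w : ι → X → K) {T : Finset ι} {a : ι} (ha : a ∉ T) (U : Finset X) :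
    injSum w (insert a T) U = ∑ x ∈ U, w a x * injSum w T (U.erase x) := by
  simp only [injSum, insert_val_of_notMem ha, Multiset.foldr_cons]
  rfl

theorem injSum_map {κ : Type*} [DecidableEq κ] (w : ι → X → K) (e : κ ↪ ι) (T : Finset κ)
    (U : Finset X) : injSum w (T.map e) U = injSum (fun k => w (e k)) T U := by
  induction T using Finset.induction_on generalizing U with
  | empty => simp [injSum_empty]
  | insert a T ha ih =>
    rw [map_insert, injSum_insert _ (by simpa using ha), injSum_insert _ ha]
    simp only [ih]

/-- An injection into `U` either avoids the point `x` or takes the value `x` at exactly one index. -/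
theorem injSum_erase_point (w : ι → X → K) (T : Finset ι) {U : Finset X} {x : X} (hx : x ∈ U) :
    injSum w T U =
      injSum w T (U.erase x) + ∑ i ∈ T, w i x * injSum w (T.erase i) (U.erase x) := by
  induction T using Finset.induction_on generalizing U with
  | empty => simp [injSum_empty]
  | insert a T ha ih =>
    have key : ∀ i ∈ T, injSum w ((insert a T).erase i) (U.erase x) =
        ∑ y ∈ U.erase x, w a y * injSum w (T.erase i) ((U.erase x).erase y) := by
      intro i hi
      have hai : a ≠ i := fun h => ha (h ▸ hi)
      rw [erase_insert_of_ne hai, injSum_insert _ (by simp [ha])]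
    have hs : ∑ i ∈ T, w i x * injSum w ((insert a T).erase i) (U.erase x) =
        ∑ i ∈ T, w i x * ∑ y ∈ U.erase x, w a y * injSum w (T.erase i) ((U.erase x).erase y) :=
      sum_congr rfl fun i hi => by rw [key i hi]
    rw [injSum_insert _ ha, injSum_insert _ ha, sum_insert ha, erase_insert ha, hs,
      ← add_sum_erase _ _ hx]
    have h2 : ∑ y ∈ U.erase x, w a y * injSum w T (U.erase y) =
        ∑ y ∈ U.erase x, (w a y * injSum w T ((U.erase x).erase y) +
          ∑ i ∈ T, w i x * (w a y * injSum w (T.erase i) ((U.erase x).erase y))) := by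
      refine sum_congr rfl fun y hy => ?_
      rw [mem_erase] at hy
      rw [ih (U := U.erase y) (mem_erase.2 ⟨hy.1.symm, hx⟩), erase_right_comm, mul_add, mul_sum]
      congr 1
      exact sum_congr rfl fun i _ => by ring
    rw [h2, sum_add_distrib, sum_comm]
    simp only [mul_sum]
    abel

/-- The sum of `v x * ∏ i ∈ T, w i (f i)` over injections `f` and points `x` outside the image of `f`:
the inclusion-exclusion over the set `S` of indices whose values are forced to be equal to `x`. -/
theorem sum_mul_injSum_erase (w : ι → X → K) (v : X → K) (T : Finset ι) (U : Finset X) :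
    ∑ x ∈ U, v x * injSum w T (U.erase x) =
      ∑ S ∈ T.powerset, (-1) ^ #S * (#S).factorial * (∑ x ∈ U, v x * ∏ i ∈ S, w i x) *
        injSum w (T \ S) U := by
  induction hn : #T using Nat.strong_induction_on generalizing T v with
  | _ n ih =>
  subst hn
  have h1 : ∑ x ∈ U, v x * injSum w T (U.erase x) = (∑ x ∈ U, v x) * injSum w T U -
      ∑ i ∈ T, ∑ x ∈ U, (v x * w i x) * injSum w (T.erase i) (U.erase x) := by
    rw [sum_comm, sum_mul, ← sum_sub_distrib]
    refine sum_congr rfl fun x hx => ?_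
    rw [injSum_erase_point w T hx, mul_add, mul_sum]
    simp only [mul_assoc]
    rw [add_sub_cancel_right]
  have h2 : ∑ i ∈ T, ∑ x ∈ U, (v x * w i x) * injSum w (T.erase i) (U.erase x) =
      ∑ S ∈ T.powerset, ∑ i ∈ S, (-1) ^ (#S - 1) * (#S - 1).factorial *
        (∑ x ∈ U, v x * ∏ i ∈ S, w i x) * injSum w (T \ S) U := by
    rw [sum_congr rfl fun i hi => ih _ (card_lt_card (erase_ssubset hi)) (fun x => v x * w i x)
      (T.erase i) rfl]
    -- A pair `(i, S)` with `i ∉ S` corresponds to the set `insert i S` with the marked element `i`.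
    rw [sum_sigma', sum_sigma']
    refine sum_bij' (fun p _ => ⟨insert p.1 p.2, p.1⟩) (fun p _ => ⟨p.2, p.1.erase p.2⟩) ?_ ?_ ?_ ?_ ?_
    · rintro ⟨i, S⟩ h
      simp only [mem_sigma, mem_powerset, subset_erase] at h ⊢
      exact ⟨insert_subset h.1 h.2.1, mem_insert_self _ _⟩
    · rintro ⟨S, i⟩ h
      simp only [mem_sigma, mem_powerset] at h ⊢
      exact ⟨h.1 h.2, erase_subset_erase _ h.1⟩
    · rintro ⟨i, S⟩ h
      simp only [mem_sigma, mem_powerset, subset_erase] at h ⊢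
      simp [erase_insert h.2.2]
    · rintro ⟨S, i⟩ h
      simp only [mem_sigma, mem_powerset] at h ⊢
      simp [insert_erase h.2]
    · rintro ⟨i, S⟩ h
      simp only [mem_sigma, mem_powerset, subset_erase] at h ⊢
      rw [card_insert_of_notMem h.2.2, Nat.add_sub_cancel]
      congr 2
      · refine sum_congr rfl fun x _ => ?_
        rw [prod_insert h.2.2, mul_assoc]
      · rw [sdiff_insert, ← erase_sdiff_comm]
  rw [h1, h2, sub_eq_iff_eq_add, ← sum_add_distrib,
    sum_eq_single_of_mem ∅ (empty_mem_powerset T)]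
  · simp
  · intro S _ hS
    obtain ⟨m, hm⟩ := Nat.exists_eq_succ_of_ne_zero (card_ne_zero.2 (nonempty_iff_ne_empty.2 hS))
    -- The `#S` choices of the marked element turn `(#S - 1)!` into `(#S)!`.
    rw [sum_const, hm, nsmul_eq_mul, Nat.factorial_succ, Nat.succ_sub_one, pow_succ]
    push_cast
    ring

theorem injSum_insert_eq_sum_powerset (w : ι → X → K) {T : Finset ι} {a : ι} (ha : a ∉ T)
    (U : Finset X) :
    injSum w (insert a T) U =
      ∑ S ∈ T.powerset, (-1) ^ #S * (#S).factorial * (∑ x ∈ U, w a x * ∏ i ∈ S, w i x) *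
        injSum w (T \ S) U := by
  rw [injSum_insert w ha, sum_mul_injSum_erase]

/-- An index of constant weight `1` can be placed at any of the points that are left. -/
theorem injSum_insert_of_one (w : ι → X → K) {T : Finset ι} {a : ι} (ha : a ∉ T)
    (hw : ∀ x, w a x = 1) (U : Finset X) :
    injSum w (insert a T) U = (#U - #T : K) * injSum w T U := by
  have h1 : ∀ x ∈ U, injSum w T (U.erase x) = injSum w T U -
      ∑ i ∈ T, w i x * injSum w (T.erase i) (U.erase x) := fun x hx => by
    rw [injSum_erase_point w T hx]; ring
  rw [injSum_insert w ha]
  simp only [hw, one_mul]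
  rw [sum_congr rfl h1, sum_sub_distrib, sum_comm, sum_const]
  rw [sum_congr rfl fun i hi => by rw [← injSum_insert w (notMem_erase i T), insert_erase hi],
    sum_const, nsmul_eq_mul, nsmul_eq_mul]
  ring

theorem injSum_fin {k : ℕ} (w : Fin k → X → K) [Fintype X] (U : Finset X) :
    injSum w univ U = ∑ f : Fin k → X with Function.Injective f ∧ ∀ i, f i ∈ U, ∏ i, w i (f i) := by
  induction k generalizing U with
  | zero =>
    rw [filter_true_of_mem fun f _ => ⟨Function.injective_of_subsingleton f, fun i => i.elim0⟩]
    simp [injSum_empty, univ_eq_empty]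
  | succ k ih =>
    have h0 : injSum w univ U = ∑ x ∈ U, w 0 x * injSum (fun i => w (Fin.succ i)) univ (U.erase x) := by
      rw [Fin.univ_succ, cons_eq_insert, injSum_insert _ (by simp)]
      simp only [injSum_map, Function.Embedding.coeFn_mk]
    simp only [h0, ih]
    rw [sum_filter, ← (Fin.consEquiv fun _ => X).sum_comp, Fintype.sum_prod_type]
    have hinj : ∀ (x : X) (f : Fin k → X), Function.Injective (Fin.consEquiv (fun _ => X) (x, f)) ↔
        (∀ i, f i ≠ x) ∧ Function.Injective f := fun x f => by
      change Function.Injective (Fin.cons x f : Fin (k + 1) → X) ↔ _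
      rw [Fin.cons_injective_iff]
      simp
    simp only [hinj, Fin.consEquiv_apply, Fin.forall_fin_succ, Fin.cons_zero,
      Fin.cons_succ, Fin.prod_univ_succ, sum_filter]
    rw [← sum_subset (subset_univ U)]
    · refine sum_congr rfl fun x hx => ?_
      rw [mul_sum]
      refine sum_congr rfl fun f _ => ?_
      rw [mul_ite, mul_zero]
      refine if_congr ?_ rfl rfl
      simp only [hx, mem_erase, true_and, forall_and]
      tauto
    · intro x _ hx
      simp [hx]

theorem injSum_univ_eq_sum_perm [Fintype X] (w : X → X → K) :
    injSum w univ univ = ∑ σ : Equiv.Perm X, ∏ i, w i (σ i) := by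
  let e := (Fintype.equivFin X).symm
  rw [← map_univ_equiv e, injSum_map, map_univ_equiv, injSum_fin]
  symm
  refine sum_bij (fun σ _ => σ ∘ e) (fun σ _ => by simp [σ.injective.comp e.injective])
    (fun σ _ τ _ h => DFunLike.coe_injective (e.surjective.injective_comp_right h))
    (fun f hf => ?_) fun σ _ => (e.prod_comp fun i => w i (σ i)).symm
  simp only [mem_filter, mem_univ, true_and, implies_true, and_true] at hf
  have hg : Function.Injective (f ∘ e.symm) := hf.comp e.symm.injective
  exact ⟨Equiv.ofBijective _ (Finite.injective_iff_bijective.1 hg), mem_univ _, by ext; simp⟩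

end InjSum

/-! ### Legendre's formula and digit sums -/

section Digits

theorem sum_digits_le_of_lt_pow {p : ℕ} (hp : 1 < p) {r m : ℕ} (h : m < p ^ r) :
    (p.digits m).sum ≤ r * (p - 1) := by
  induction r generalizing m with
  | zero => simp_all
  | succ r ih =>
    rcases Nat.eq_zero_or_pos m with rfl | hm
    · simp
    · rw [Nat.digits_def' hp hm, List.sum_cons]
      have h1 := ih (m := m / p) (Nat.div_lt_of_lt_mul (by rwa [pow_succ'] at h))
      have h2 := Nat.mod_lt m (by omega : p > 0)
      rw [Nat.succ_mul]
      omega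

/-- Only `p ^ r - 1` attains the maximal digit sum. -/
theorem sum_digits_lt_of_succ_lt_pow {p : ℕ} (hp : 1 < p) {r m : ℕ} (h : m + 1 < p ^ r) :
    (p.digits m).sum < r * (p - 1) := by
  induction r generalizing m with
  | zero => simp_all
  | succ r ih =>
    rcases Nat.eq_zero_or_pos m with rfl | hm
    · simp only [Nat.digits_zero, List.sum_nil]
      exact Nat.mul_pos (Nat.succ_pos _) (by omega)
    · rw [Nat.digits_def' hp hm, List.sum_cons, Nat.succ_mul]
      have h2 := Nat.mod_lt m (by omega : p > 0)
      have h3 := Nat.div_add_mod m p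
      rw [pow_succ'] at h
      -- Either the leading part is not maximal, or the last digit is not.
      by_cases h4 : m / p + 1 < p ^ r
      · have := ih h4
        omega
      · have h5 : m / p < p ^ r := Nat.div_lt_of_lt_mul (by omega)
        have h6 : p ^ r = m / p + 1 := by omega
        have := sum_digits_le_of_lt_pow hp h5
        rw [h6, mul_add] at h
        omega

/-- A zero-sum block of size `m + 1 < p ^ r` contributes `± m! * p ^ r`, whose `p`-adic valuation is at
least `(m + 1) / (p - 1)`. -/
theorem succ_le_sub_one_mul_add_padicValNat_factorial {p r m : ℕ} [Fact p.Prime] (h : m + 1 < p ^ r) :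
    m + 1 ≤ (p - 1) * (r + padicValNat p m.factorial) := by
  have h1 := sum_digits_lt_of_succ_lt_pow (Fact.out : p.Prime).one_lt h
  have h2 := Nat.digit_sum_le p m
  rw [mul_add, sub_one_mul_padicValNat_factorial, mul_comm (p - 1)]
  omega

end Digits

/-! ### Integers of prescribed divisibility -/

section Divisibility

/-- `c` is an integer divisible by `p ^ v` for some `v ≥ k / (p - 1)`. Speaking of a witness `v` instead of
a valuation lets zero satisfy the predicate for every `k`. -/
def IsIntOfDivisibility (p k : ℕ) (c : ℂ) : Prop :=
  ∃ z : ℤ, c = z ∧ ∃ v : ℕ, k ≤ (p - 1) * v ∧ (p : ℤ) ^ v ∣ z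

namespace IsIntOfDivisibility
variable {p k l : ℕ} {c d : ℂ}

theorem zero (hp : 1 < p) : IsIntOfDivisibility p k 0 :=
  ⟨0, by simp, k, Nat.le_mul_of_pos_left _ (by omega), dvd_zero _⟩

theorem add (hc : IsIntOfDivisibility p k c) (hd : IsIntOfDivisibility p k d) :
    IsIntOfDivisibility p k (c + d) := by
  obtain ⟨y, rfl, v, hv, hy⟩ := hc
  obtain ⟨z, rfl, u, hu, hz⟩ := hd
  refine ⟨y + z, by push_cast; rfl, min v u, ?_, ?_⟩
  · rcases min_choice v u with h | h <;> rwa [h]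
  · exact dvd_add ((pow_dvd_pow _ (min_le_left _ _)).trans hy)
      ((pow_dvd_pow _ (min_le_right _ _)).trans hz)

theorem mul (hc : IsIntOfDivisibility p k c) (hd : IsIntOfDivisibility p l d) :
    IsIntOfDivisibility p (k + l) (c * d) := by
  obtain ⟨y, rfl, v, hv, hy⟩ := hc
  obtain ⟨z, rfl, u, hu, hz⟩ := hd
  refine ⟨y * z, by push_cast; rfl, v + u, ?_, ?_⟩
  · rw [mul_add]; omega
  · rw [pow_add]; exact mul_dvd_mul hy hz

theorem sum (hp : 1 < p) {α : Type*} {s : Finset α} {f : α → ℂ}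
    (h : ∀ a ∈ s, IsIntOfDivisibility p k (f a)) : IsIntOfDivisibility p k (∑ a ∈ s, f a) := by
  classical
  induction s using Finset.induction_on with
  | empty => simpa using zero hp
  | insert a s ha ih =>
    rw [sum_insert ha]
    exact (h a (mem_insert_self _ _)).add (ih fun b hb => h b (mem_insert_of_mem hb))

theorem factorial_mul_pow [Fact p.Prime] {r m : ℕ} (h : m + 1 < p ^ r) :
    IsIntOfDivisibility p (m + 1) ((-1) ^ m * m.factorial * (p ^ r : ℕ)) := by
  refine ⟨(-1) ^ m * (m.factorial * (p ^ r : ℕ)), by push_cast; ring, _,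
    succ_le_sub_one_mul_add_padicValNat_factorial h, ?_⟩
  refine dvd_mul_of_dvd_right ?_ _
  rw [pow_add, mul_comm]
  refine mul_dvd_mul ?_ (by push_cast; rfl)
  exact_mod_cast pow_padicValNat_dvd

/-- The `p`-adic valuation of `k!` is smaller than `k / (p - 1)`, so `k!` is not cancelled. -/
theorem factorial_add_ne_zero [Fact p.Prime] (hk : k ≠ 0) (hc : IsIntOfDivisibility p k c) (m : ℕ) :
    (-1) ^ m * (k.factorial : ℂ) + c ≠ 0 := by
  obtain ⟨z, rfl, v, hv, hz⟩ := hc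
  intro h
  have h1 : (-1) ^ m * (k.factorial : ℤ) + z = 0 := by exact_mod_cast h
  have h2 : (p : ℤ) ^ v ∣ (k.factorial : ℤ) := by
    have : (p : ℤ) ^ v ∣ (-1) ^ m * (k.factorial : ℤ) := by
      rw [eq_neg_of_add_eq_zero_left h1]; exact hz.neg_right
    rcases neg_one_pow_eq_or ℤ m with h | h <;> rw [h] at this <;> simpa using this
  have h3 : p ^ v ∣ k.factorial := by exact_mod_cast h2
  have h4 := (padicValNat_dvd_iff_le (Nat.factorial_ne_zero k)).1 h3
  have h5 := sub_one_mul_padicValNat_factorial_lt_of_ne_zero p hk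
  have h6 := Nat.mul_le_mul_left (p - 1) h4
  omega

end IsIntOfDivisibility
end Divisibility

/-! ### Sums of roots of unity over injections -/

section CharSum

theorem eq_of_natCast_eq_zero_of_le {N m : ℕ} (h0 : 0 < m) (h1 : m ≤ N) (h : (m : ZMod N) = 0) :
    m = N := by
  rw [ZMod.natCast_eq_zero_iff] at h
  exact le_antisymm h1 (Nat.le_of_dvd h0 h)

variable {N : ℕ} [NeZero N] {ι : Type*}

/-- The sum of `∏ i ∈ T, ζ ^ (f i * b i)` over the injections `f : T → ℤ/N`, for the primitive `N`-th root
of unity `ζ = exp (2πi / N)`. -/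
noncomputable def rootSum (b : ι → ZMod N) (T : Finset ι) : ℂ :=
  injSum (fun i (x : ZMod N) => (ZMod.stdAddChar (x * b i) : ℂ)) T univ

theorem rootSum_empty (b : ι → ZMod N) : rootSum b ∅ = 1 := injSum_empty _ _

variable [DecidableEq ι]

/-- Expansion over the blocks `insert a S` that contain `a`: only those with zero `b`-sum contribute. -/
theorem rootSum_insert (b : ι → ZMod N) {T : Finset ι} {a : ι} (ha : a ∉ T) :
    rootSum b (insert a T) = ∑ S ∈ T.powerset, (-1) ^ #S * (#S).factorial *
      (if b a + ∑ i ∈ S, b i = 0 then (N : ℂ) else 0) * rootSum b (T \ S) := by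
  rw [rootSum, injSum_insert_eq_sum_powerset _ ha]
  refine sum_congr rfl fun S _ => ?_
  have h : ∑ x : ZMod N, (ZMod.stdAddChar (x * b a) : ℂ) * ∏ i ∈ S, ZMod.stdAddChar (x * b i) =
      if b a + ∑ i ∈ S, b i = 0 then (N : ℂ) else 0 := by
    have := AddChar.sum_mulShift (b a + ∑ i ∈ S, b i) (ZMod.isPrimitive_stdAddChar N)
    rw [ZMod.card, Nat.cast_ite, Nat.cast_zero] at this
    rw [← this]
    refine sum_congr rfl fun x _ => ?_
    rw [mul_add, AddChar.map_add_eq_mul, mul_sum]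
    exact congrArg _ (map_prod (ZMod.stdAddChar (N := N)).toMonoidHom
      (fun i => Multiplicative.ofAdd (x * b i)) S).symm
  rw [h]
  rfl

theorem rootSum_insert_of_eq_zero (b : ι → ZMod N) {T : Finset ι} {a : ι} (ha : a ∉ T)
    (hb : b a = 0) : rootSum b (insert a T) = (N - #T) * rootSum b T := by
  rw [rootSum, injSum_insert_of_one _ ha (by simp [hb]), card_univ, ZMod.card]
  rfl

/-- Splitting off one block after another, each block of size `s` contributes divisibility `s`. -/
theorem isIntOfDivisibility_rootSum {p r : ℕ} [Fact p.Prime] (hN : N = p ^ r) (b : ι → ZMod N)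
    (T : Finset ι) (hT : #T < N) : IsIntOfDivisibility p #T (rootSum b T) := by
  have hp := (Fact.out : p.Prime).one_lt
  induction hn : #T using Nat.strong_induction_on generalizing T with
  | _ n ih =>
  subst hn
  rcases T.eq_empty_or_nonempty with rfl | ⟨a, ha⟩
  · exact ⟨1, by simp [rootSum_empty], 0, by simp, by simp⟩
  · have hc := card_erase_add_one ha
    rw [← insert_erase ha, rootSum_insert b (notMem_erase a T), card_insert_of_notMem (by simp)]
    refine .sum hp fun S hS => ?_
    rw [mem_powerset] at hS
    have hSc := card_le_card hS
    have hd := card_sdiff_of_subset hS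
    have h1 := ih _ (by omega) (T.erase a \ S) (by omega) rfl
    split_ifs
    · have h2 := (IsIntOfDivisibility.factorial_mul_pow (p := p) (r := r) (m := #S)
        (by rw [← hN]; omega)).mul h1
      rw [← hN] at h2
      convert h2 using 1
      omega
    · simpa using IsIntOfDivisibility.zero hp

/-- The block consisting of all indices contributes `± N!`, and all other terms are too divisible to
cancel it. -/
theorem rootSum_ne_zero {p r : ℕ} [Fact p.Prime] (hN : N = p ^ r) (b : ι → ZMod N)
    (T : Finset ι) (hT : #T = N) (hb : ∑ i ∈ T, b i = 0) : rootSum b T ≠ 0 := by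
  have hp := (Fact.out : p.Prime).one_lt
  have hN0 := NeZero.ne N
  obtain ⟨a, ha⟩ := card_ne_zero.1 (hT ▸ hN0)
  have hc := card_erase_add_one ha
  rw [← insert_erase ha, rootSum_insert b (notMem_erase a T),
    ← add_sum_erase _ _ (mem_powerset_self _), add_sum_erase _ _ ha, hb, if_pos rfl, Finset.sdiff_self,
    rootSum_empty, mul_one, mul_assoc, ← Nat.cast_mul, mul_comm _ N]
  have hf : N * (#(T.erase a)).factorial = N.factorial := by
    rw [show #(T.erase a) = N - 1 by omega, Nat.mul_factorial_pred hN0]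
  rw [hf]
  refine IsIntOfDivisibility.factorial_add_ne_zero (p := p) hN0 (.sum hp fun S hS => ?_) _
  rw [mem_erase, mem_powerset] at hS
  have hSc := card_lt_card (hS.2.ssubset_of_ne hS.1)
  have hd := card_sdiff_of_subset hS.2
  have h1 := isIntOfDivisibility_rootSum hN b (T.erase a \ S) (by omega)
  split_ifs
  · have h2 := (IsIntOfDivisibility.factorial_mul_pow (p := p) (r := r) (m := #S)
      (by rw [← hN]; omega)).mul h1
    rw [← hN] at h2
    convert h2 using 1
    omega
  · simpa using IsIntOfDivisibility.zero hp

theorem rootSum_eq_zero_of_subset (b : ι → ZMod N) {T T' : Finset ι} (h : T ⊆ T')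
    (hb : ∀ i ∈ T', i ∉ T → b i = 0) (hT : rootSum b T = 0) : rootSum b T' = 0 := by
  suffices ∀ Z : Finset ι, Disjoint T Z → (∀ i ∈ Z, b i = 0) → rootSum b (T ∪ Z) = 0 by
    rw [← union_sdiff_of_subset h]
    exact this _ disjoint_sdiff fun i hi => hb i (mem_sdiff.1 hi).1 (mem_sdiff.1 hi).2
  intro Z hZ hz
  induction Z using Finset.induction_on with
  | empty => simpa using hT
  | insert a Z ha ih =>
    rw [disjoint_insert_right] at hZ
    rw [union_insert, rootSum_insert_of_eq_zero b (by simp [ha, hZ.1]) (hz a (mem_insert_self _ _)),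
      ih hZ.2 fun i hi => hz i (mem_insert_of_mem hi), mul_zero]


/-- No proper nonempty set of indices has zero `b`-sum, so only the full block contributes. -/
theorem rootSum_of_sum_eq (b : ι → ZMod N) (c : ι → ℕ) (T : Finset ι) (hb : ∀ i ∈ T, b i = c i)
    (hc : ∀ i ∈ T, 0 < c i) (hs : ∑ i ∈ T, c i = N) :
    rootSum b T = (-1) ^ (#T - 1) * (#T - 1).factorial * N := by
  have hT : T.Nonempty := by
    rw [nonempty_iff_ne_empty]
    rintro rfl
    exact NeZero.ne N (by simpa using hs.symm)
  obtain ⟨a, ha⟩ := hT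
  have hba : ∀ S ⊆ T.erase a, b a + ∑ i ∈ S, b i = ((c a + ∑ i ∈ S, c i : ℕ) : ZMod N) := by
    intro S hS
    push_cast
    rw [hb a ha, sum_congr rfl fun i hi => hb i (mem_of_mem_erase (hS hi))]
  have hs' : c a + ∑ i ∈ T.erase a, c i = N := by rw [add_sum_erase _ _ ha, hs]
  conv_lhs => rw [← insert_erase ha]
  rw [rootSum_insert b (notMem_erase a T), sum_eq_single_of_mem _ (mem_powerset_self _),
    hba _ Subset.rfl, hs', ZMod.natCast_self, if_pos rfl, Finset.sdiff_self, rootSum_empty,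
    card_erase_of_mem ha, mul_one]
  intro S hS hne
  rw [mem_powerset] at hS
  rw [hba S hS, if_neg, mul_zero, zero_mul]
  intro h
  have hlt : ∑ i ∈ S, c i < ∑ i ∈ T.erase a, c i := by
    obtain ⟨j, hj, hjS⟩ := exists_of_ssubset (hS.ssubset_of_ne hne)
    exact sum_lt_sum_of_subset hS hj hjS (hc j (mem_of_mem_erase hj)) fun _ _ _ => Nat.zero_le _
  have := eq_of_natCast_eq_zero_of_le (by have := hc a ha; omega) (by omega) h
  omega

/-- The block of the index `a`, where `b` is `-1`, is either everything or a pair of `a` and an index where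
`b` is `1`. The two kinds of contribution cancel. -/
theorem rootSum_eq_zero (hN : 1 < N) (b : ι → ZMod N) (c : ι → ℕ) (T : Finset ι) {a : ι} {k : ℕ}
    (hk : 0 < k) (ha : a ∉ T) (hba : b a = -1) (hb : ∀ i ∈ T, b i = c i) (hc : ∀ i ∈ T, 0 < c i)
    (hs : ∑ i ∈ T, c i = N + 1) (hT : #T = k + 1)
    (hcount : #{i ∈ T | c i = 1} * N = k * (k + 1)) : rootSum b (insert a T) = 0 := by
  have : Fact (1 < N) := ⟨hN⟩
  -- A nonempty subset of `T` has `c`-sum between `1` and `N + 1`, and these are the only values congruent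
  -- to `1`; they are attained by the singletons with `c i = 1` and by `T`.
  have hbS : ∀ S ⊆ T, b a + ∑ i ∈ S, b i = 0 ↔ S = T ∨ ∃ i ∈ T, c i = 1 ∧ {i} = S := by
    intro S hS
    rw [hba, neg_add_eq_zero, sum_congr rfl fun i hi => hb i (hS hi)]
    constructor
    · intro h
      rcases S.eq_empty_or_nonempty with rfl | ⟨j, hj⟩
      · simp at h
      have hjle : c j + ∑ i ∈ S.erase j, c i = ∑ i ∈ S, c i := add_sum_erase _ _ hj
      have hcj := hc j (hS hj)
      rcases eq_or_ne S T with hST | hST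
      · exact .inl hST
      right
      have hlt : ∑ i ∈ S, c i < ∑ i ∈ T, c i := by
        obtain ⟨l, hl, hlS⟩ := exists_of_ssubset (hS.ssubset_of_ne hST)
        exact sum_lt_sum_of_subset hS hl hlS (hc l hl) fun _ _ _ => Nat.zero_le _
      have hone : ∑ i ∈ S, c i = 1 := by
        by_contra hne
        have := eq_of_natCast_eq_zero_of_le (N := N) (m := ∑ i ∈ S, c i - 1) (by omega) (by omega)
          (by rw [Nat.cast_sub (by omega)]; push_cast; rw [← h]; simp)
        omega
      refine ⟨j, hS hj, by omega, ?_⟩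
      symm
      rw [eq_singleton_iff_unique_mem]
      refine ⟨hj, fun l hl => ?_⟩
      by_contra hlj
      have h1 := single_le_sum (f := c) (fun _ _ => Nat.zero_le _) (mem_erase.2 ⟨hlj, hl⟩)
      have h2 := hc l (hS hl)
      omega
    · rintro (rfl | ⟨i, hi, hi1, rfl⟩)
      · rw [← Nat.cast_sum, hs]; simp
      · simp [hi1]
  have hTimg : T ∉ image (fun i => ({i} : Finset ι)) {i ∈ T | c i = 1} := by
    intro h
    obtain ⟨i, _, hi⟩ := mem_image.1 h
    rw [← hi, card_singleton] at hT
    omega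
  have hsub : insert T (image (fun i => ({i} : Finset ι)) {i ∈ T | c i = 1}) ⊆ T.powerset := by
    intro S hS
    simp only [mem_insert, mem_image, mem_filter] at hS
    rcases hS with rfl | ⟨i, hi, rfl⟩
    · exact mem_powerset_self _
    · simpa using hi.1
  rw [rootSum_insert b ha, ← sum_subset hsub, sum_insert hTimg,
    sum_image fun i _ j _ h => singleton_injective h]
  · have hterm : ∀ i ∈ ({i ∈ T | c i = 1} : Finset ι), (-1 : ℂ) ^ #({i} : Finset ι) *
        (#({i} : Finset ι)).factorial * (if b a + ∑ j ∈ ({i} : Finset ι), b j = 0 then (N : ℂ) else 0)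
          * rootSum b (T \ {i}) = -(N * ((-1) ^ (k - 1) * (k - 1).factorial * N)) := by
      intro i hi
      rw [mem_filter] at hi
      have hsum := add_sum_erase T c hi.1
      rw [if_pos ((hbS {i} (by simpa using hi.1)).2 (.inr ⟨i, hi.1, hi.2, rfl⟩)),
        sdiff_singleton_eq_erase, rootSum_of_sum_eq b c (T.erase i)
          (fun j hj => hb j (mem_of_mem_erase hj)) (fun j hj => hc j (mem_of_mem_erase hj)) (by omega),
        card_erase_of_mem hi.1, hT]
      simp
    rw [sum_congr rfl hterm, sum_const, nsmul_eq_mul, if_pos ((hbS T Subset.rfl).2 (.inl rfl)),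
      Finset.sdiff_self, rootSum_empty, hT]
    have hcount' : (#{i ∈ T | c i = 1} : ℂ) * N = k * (k + 1) := by exact_mod_cast hcount
    obtain ⟨m, rfl⟩ := Nat.exists_eq_succ_of_ne_zero hk.ne'
    simp only [Nat.succ_eq_add_one, Nat.add_sub_cancel, Nat.factorial_succ] at hcount' ⊢
    push_cast at hcount' ⊢
    linear_combination (-(N : ℂ) * (-1) ^ m * m.factorial) * hcount'
  · intro S hS hS'
    rw [if_neg, mul_zero, zero_mul]
    rw [hbS S (mem_powerset.1 hS)]
    intro h
    apply hS'
    simp only [mem_insert, mem_image, mem_filter]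
    rcases h with h | ⟨i, hi, hi1, h⟩
    · exact .inl h
    · exact .inr ⟨i, ⟨hi, hi1⟩, h⟩

end CharSum

/-! ### Coefficients of the determinant and the permanent -/

section Content
variable {G : Type*} [Fintype G]

/-- The exponent vector of the monomial `∏ x, X_{g x}`. -/
noncomputable def content (g : G → G) : G →₀ ℕ := ∑ x, Finsupp.single (g x) 1

theorem content_comp_perm (g : G → G) (σ : Equiv.Perm G) : content (g ∘ σ) = content g :=
  Equiv.sum_comp σ fun x => Finsupp.single (g x) 1

variable [DecidableEq G]

theorem content_apply (g : G → G) (c : G) : content g c = Fintype.card {x // g x = c} := by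
  rw [content, Finsupp.finsetSum_apply, Fintype.card_subtype, card_filter]
  exact sum_congr rfl fun x _ => by rw [Finsupp.single_apply]

theorem exists_perm_of_content_eq {g h : G → G} (e : content g = content h) :
    ∃ σ : Equiv.Perm G, g = h ∘ σ := by
  have (c : G) : Nonempty ({x // g x = c} ≃ {x // h x = c}) := by
    rw [← Fintype.card_eq, ← content_apply, ← content_apply, e]
  exact ⟨Equiv.ofFiberEquiv fun c => (this c).some, funext fun x => (Equiv.ofFiberEquiv_map _ x).symm⟩

end Content

section Circulant
variable (R : Type*) [CommRing R] (N : ℕ) [NeZero N]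

/-- The generic circulant matrix with rows and columns indexed by `ZMod N`, which for `N = n + 1` is
`Fin N` by definition. -/
noncomputable def zmodCirculant : Matrix (ZMod N) (ZMod N) (MvPolynomial (ZMod N) R) :=
  .of fun i j => X (j - i)

theorem prod_X_eq_monomial (g : ZMod N → ZMod N) :
    ∏ i, (X (g i) : MvPolynomial (ZMod N) R) = monomial (content g) 1 := by
  rw [content, monomial_sum_one]
  rfl

theorem coeff_permanent (a : ZMod N →₀ ℕ) : coeff a (zmodCirculant R N).permanent =
    #{σ : Equiv.Perm (ZMod N) | content (fun i => σ i - i) = a} := by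
  rw [← Matrix.permanent_transpose, Matrix.permanent]
  simp only [Matrix.transpose_apply, zmodCirculant, Matrix.of_apply, coeff_sum]
  rw [card_filter, Nat.cast_sum]
  refine sum_congr rfl fun σ _ => ?_
  rw [prod_X_eq_monomial R N fun i => σ i - i, coeff_monomial]
  split_ifs <;> simp

theorem coeff_det (a : ZMod N →₀ ℕ) : coeff a (zmodCirculant R N).det =
    (∑ σ : Equiv.Perm (ZMod N) with content (fun i => σ i - i) = a, (σ.sign : ℤ) : ℤ) := by
  rw [← Matrix.det_transpose, Matrix.det_apply']
  simp only [Matrix.transpose_apply, zmodCirculant, Matrix.of_apply, coeff_sum]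
  rw [sum_filter, Int.cast_sum]
  refine sum_congr rfl fun σ _ => ?_
  rw [prod_X_eq_monomial R N fun i => σ i - i,
    ← map_intCast (C : R →+* MvPolynomial (ZMod N) R), coeff_C_mul, coeff_monomial]
  split_ifs <;> simp

/-- The coefficients of the determinant are integers that do not depend on the ring. -/
theorem coeff_det_eq_zero_iff [CharZero R] (S : Type*) [CommRing S] [CharZero S]
    (a : ZMod N →₀ ℕ) :
    coeff a (zmodCirculant R N).det = 0 ↔ coeff a (zmodCirculant S N).det = 0 := by
  rw [coeff_det, coeff_det]
  norm_cast

/-- The characters of `ℤ/N` are the eigenvectors of a circulant matrix. -/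
theorem det_complex : (zmodCirculant ℂ N).det =
    ∏ x : ZMod N, ∑ c : ZMod N, C (ZMod.stdAddChar (x * c) : ℂ) * X c := by
  -- The matrix of eigenvectors and a multiple of its inverse.
  let V : Matrix (ZMod N) (ZMod N) ℂ := .of fun i x => ZMod.stdAddChar (x * i)
  let V' : Matrix (ZMod N) (ZMod N) ℂ := .of fun x i => ZMod.stdAddChar (-(x * i))
  have hV : V * V' = (N : ℂ) • 1 := by
    ext i j
    have := AddChar.sum_mulShift (i - j) (ZMod.isPrimitive_stdAddChar N)
    rw [ZMod.card, Nat.cast_ite, Nat.cast_zero] at this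
    simp only [V, V', Matrix.mul_apply, Matrix.of_apply, ← AddChar.map_add_eq_mul,
      Matrix.smul_apply, Matrix.one_apply, smul_eq_mul, mul_ite, mul_one, mul_zero,
      ← sub_eq_zero (a := i)]
    rw [← this]
    exact sum_congr rfl fun x _ => by rw [mul_sub, sub_eq_add_neg]
  have hdet : V.det ≠ 0 := by
    intro h
    have := congrArg Matrix.det hV
    rw [Matrix.det_mul, h, zero_mul, Matrix.det_smul, Matrix.det_one, mul_one] at this
    exact pow_ne_zero _ (Nat.cast_ne_zero.2 (NeZero.ne N)) this.symm
  let W := V.map (C : ℂ →+* MvPolynomial (ZMod N) ℂ)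
  have hW : W.det ≠ 0 := by
    rw [show W.det = C V.det from (RingHom.map_det C V).symm]
    simpa using hdet
  have hmul : zmodCirculant ℂ N * W = W * Matrix.diagonal fun x : ZMod N =>
      ∑ c : ZMod N, C (ZMod.stdAddChar (x * c) : ℂ) * X c := by
    ext1 i x
    rw [Matrix.mul_apply, Matrix.mul_diagonal, mul_sum, ← Equiv.sum_comp (Equiv.addRight i)]
    refine sum_congr rfl fun c _ => ?_
    simp only [zmodCirculant, W, V, Matrix.of_apply, Matrix.map_apply, Equiv.coe_addRight,
      add_sub_cancel_right, mul_add, AddChar.map_add_eq_mul, map_mul]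
    ring
  have := congrArg Matrix.det hmul
  rw [Matrix.det_mul, Matrix.det_mul, mul_comm, Matrix.det_diagonal] at this
  exact mul_left_cancel₀ hW this

theorem coeff_det_complex (a : ZMod N →₀ ℕ) : coeff a (zmodCirculant ℂ N).det =
    ∑ g : ZMod N → ZMod N with content g = a, ∏ x, (ZMod.stdAddChar (x * g x) : ℂ) := by
  rw [det_complex, prod_univ_sum, Fintype.piFinset_univ, coeff_sum, sum_filter]
  refine sum_congr rfl fun g _ => ?_
  rw [prod_mul_distrib, prod_X_eq_monomial, ← map_prod, coeff_C_mul, coeff_monomial]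
  split_ifs <;> simp

variable {N}

theorem rootSum_univ (g : ZMod N → ZMod N) : rootSum g univ =
    ∑ σ : Equiv.Perm (ZMod N), ∏ x, (ZMod.stdAddChar (x * (g ∘ σ) x) : ℂ) := by
  rw [rootSum, injSum_univ_eq_sum_perm, ← Equiv.sum_comp (Equiv.inv (Equiv.Perm (ZMod N)))]
  refine sum_congr rfl fun σ _ => ?_
  rw [← Equiv.prod_comp σ]
  simp

theorem rootSum_comp_perm (g : ZMod N → ZMod N) (τ : Equiv.Perm (ZMod N)) :
    rootSum (g ∘ τ) univ = rootSum g univ := by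
  rw [rootSum_univ, rootSum_univ]
  exact Equiv.sum_comp (Equiv.mulLeft τ) fun σ => ∏ x, (ZMod.stdAddChar (x * (g ∘ σ) x) : ℂ)

/-- Averaging the coefficient over the permutations of the index set: the functions with the same content
as `b` are the rearrangements of `b`, and all have the same `rootSum`. -/
theorem factorial_mul_coeff_det (b : ZMod N → ZMod N) :
    N.factorial * coeff (content b) (zmodCirculant ℂ N).det =
      #{g : ZMod N → ZMod N | content g = content b} * rootSum b univ := by
  have h1 : ∀ σ : Equiv.Perm (ZMod N), coeff (content b) (zmodCirculant ℂ N).det =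
      ∑ g : ZMod N → ZMod N with content g = content b,
        ∏ x, (ZMod.stdAddChar (x * (g ∘ σ) x) : ℂ) := by
    intro σ
    rw [coeff_det_complex, sum_filter, sum_filter, ← (σ.arrowCongr (.refl _)).symm.sum_comp]
    refine sum_congr rfl fun g _ => ?_
    rw [← content_comp_perm g σ]
    rfl
  have h2 : N.factorial * coeff (content b) (zmodCirculant ℂ N).det =
      ∑ _σ : Equiv.Perm (ZMod N), coeff (content b) (zmodCirculant ℂ N).det := by
    rw [sum_const, card_univ, Fintype.card_perm, ZMod.card, nsmul_eq_mul]
  rw [h2, sum_congr rfl fun σ _ => h1 σ, sum_comm, ← nsmul_eq_mul, ← sum_const]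
  refine sum_congr rfl fun g hg => ?_
  obtain ⟨τ, rfl⟩ := exists_perm_of_content_eq (mem_filter.1 hg).2
  rw [← rootSum_univ, rootSum_comp_perm]

theorem coeff_det_content_eq_zero_iff [CharZero R] (b : ZMod N → ZMod N) :
    coeff (content b) (zmodCirculant R N).det = 0 ↔ rootSum b univ = 0 := by
  rw [coeff_det_eq_zero_iff R N ℂ]
  have h := factorial_mul_coeff_det b
  have h1 : (N.factorial : ℂ) ≠ 0 := Nat.cast_ne_zero.2 (Nat.factorial_ne_zero _)
  have h2 : (#{g : ZMod N → ZMod N | content g = content b} : ℂ) ≠ 0 :=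
    Nat.cast_ne_zero.2 (card_ne_zero.2 ⟨b, by simp⟩)
  constructor <;> intro h0 <;> simp_all

variable (N)

theorem card_support_det_eq_iff [CharZero R] :
    #(zmodCirculant R N).det.support = #(zmodCirculant R N).permanent.support ↔
      ∀ σ : Equiv.Perm (ZMod N), rootSum (fun i => σ i - i) univ ≠ 0 := by
  have hperm (a) : a ∈ (zmodCirculant R N).permanent.support ↔
      ∃ σ : Equiv.Perm (ZMod N), content (fun i => σ i - i) = a := by
    rw [mem_support_iff, coeff_permanent, Nat.cast_ne_zero, card_ne_zero]
    simp [Finset.Nonempty]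
  have hsub : (zmodCirculant R N).det.support ⊆ (zmodCirculant R N).permanent.support := by
    intro a ha
    rw [hperm]
    by_contra! h
    rw [mem_support_iff, coeff_det, filter_false_of_mem fun σ _ => h σ] at ha
    simp at ha
  constructor
  · intro h σ
    rw [Ne, ← coeff_det_content_eq_zero_iff R, ← Ne, ← mem_support_iff,
      eq_of_subset_of_card_le hsub h.ge, hperm]
    exact ⟨σ, rfl⟩
  · intro h
    refine congrArg card (hsub.antisymm fun a ha => ?_)
    obtain ⟨σ, rfl⟩ := (hperm a).1 ha
    rw [mem_support_iff, Ne, coeff_det_content_eq_zero_iff]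
    exact h σ

end Circulant

/-! ### A vanishing coefficient when the size is not a prime power -/

section NonPrimePower

/-- For `N = D + 2 * m + e`, the permutation of `{0, …, N - 1}` that runs through the cycle
`0 → D → D - 1 → D + 1 → ⋯ → E → E + 1 → ⋯ → N - 1 → 0`, where `E = D - 1 + 2 * m`, the steps from
`D - 1` to `E` being `+2` and those from `E` on being `+1` modulo `N`. All other points are fixed. -/
def circPerm (D m N x : ℕ) : ℕ :=
  if x = 0 then D
  else if x < D - 1 then x
  else if x = D then D - 1
  else if x < D - 1 + 2 * m then (if (x - (D - 1)) % 2 = 0 then x + 2 else x)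
  else if x + 1 < N then x + 1 else 0

/-- The step of `circPerm` at a point of `stepSet`: `D` at `0`, then `2`, and `1` at the end. -/
def stepSize (D m x : ℕ) : ℕ :=
  if x = 0 then D else if x < D - 1 + 2 * m then 2 else 1

/-- The points that `circPerm` moves forwards modulo `N`. The only other point it moves is `D`, which
goes to `D - 1`. -/
def stepSet (D m N : ℕ) : Finset ℕ :=
  insert 0 ((range m).image (fun j => D - 1 + 2 * j) ∪ Ico (D - 1 + 2 * m) N)

variable {D m e N : ℕ}

theorem circPerm_lt (hD : 2 ≤ D) (hm : 1 ≤ m) (hN : N = D + 2 * m + e) {x : ℕ} (hx : x < N) :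
    circPerm D m N x < N := by
  unfold circPerm
  split_ifs <;> omega

theorem circPerm_injOn (hD : 2 ≤ D) (hm : 1 ≤ m) (hN : N = D + 2 * m + e) {x y : ℕ}
    (hx : x < N) (hy : y < N) (h : circPerm D m N x = circPerm D m N y) : x = y := by
  unfold circPerm at h
  split_ifs at h <;> omega

theorem disjoint_steps : Disjoint ((range m).image fun j => D - 1 + 2 * j)
    (Ico (D - 1 + 2 * m) N) := by
  rw [disjoint_left]
  simp only [mem_image, mem_range, mem_Ico]
  omega

theorem zero_notMem_steps (hD : 2 ≤ D) :
    0 ∉ (range m).image (fun j => D - 1 + 2 * j) ∪ Ico (D - 1 + 2 * m) N := by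
  simp only [mem_union, mem_image, mem_range, mem_Ico]
  omega

theorem injOn_steps : Set.InjOn (fun j => D - 1 + 2 * j) (range m : Set ℕ) :=
  fun i _ j _ h => by simpa using h

theorem card_stepSet (hD : 2 ≤ D) (hN : N = D + 2 * m + e) : #(stepSet D m N) = e + m + 1 + 1 := by
  rw [stepSet, card_insert_of_notMem (zero_notMem_steps hD), card_union_of_disjoint disjoint_steps,
    card_image_of_injOn injOn_steps, card_range, Nat.card_Ico]
  omega

theorem sum_stepSize (hD : 2 ≤ D) (hN : N = D + 2 * m + e) :
    ∑ x ∈ stepSet D m N, stepSize D m x = N + 1 := by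
  have h2 : ∀ j ∈ range m, stepSize D m (D - 1 + 2 * j) = 2 := by
    intro j hj
    rw [mem_range] at hj
    unfold stepSize
    split_ifs <;> omega
  have h1 : ∀ x ∈ Ico (D - 1 + 2 * m) N, stepSize D m x = 1 := by
    intro x hx
    rw [mem_Ico] at hx
    unfold stepSize
    split_ifs <;> omega
  rw [stepSet, sum_insert (zero_notMem_steps hD), sum_union disjoint_steps, sum_image injOn_steps,
    sum_congr rfl h2, sum_congr rfl h1, sum_const, sum_const, card_range, Nat.card_Ico, stepSize,
    if_pos rfl]
  simp only [smul_eq_mul]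
  omega

theorem card_stepSize_eq_one (hD : 2 ≤ D) (hm : 1 ≤ m) (hN : N = D + 2 * m + e) :
    #{x ∈ stepSet D m N | stepSize D m x = 1} = e + 1 := by
  have : {x ∈ stepSet D m N | stepSize D m x = 1} = Ico (D - 1 + 2 * m) N := by
    ext x
    simp only [stepSet, mem_filter, mem_insert, mem_union, mem_image, mem_range, mem_Ico]
    unfold stepSize
    split_ifs <;> omega
  rw [this, Nat.card_Ico]
  omega

theorem stepSize_pos (hD : 2 ≤ D) (x : ℕ) : 0 < stepSize D m x := by
  unfold stepSize
  split_ifs <;> omega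

theorem circPerm_sub (hD : 2 ≤ D) (hm : 1 ≤ m) (hN : N = D + 2 * m + e) {x : ℕ}
    (hx : x ∈ stepSet D m N) : (circPerm D m N x - x : ZMod N) = stepSize D m x := by
  rw [sub_eq_iff_eq_add, ← Nat.cast_add]
  have : circPerm D m N x = stepSize D m x + x ∨
      circPerm D m N x = 0 ∧ stepSize D m x + x = N := by
    simp only [stepSet, mem_insert, mem_union, mem_image, mem_range, mem_Ico] at hx
    unfold stepSize circPerm
    rcases hx with hx | ⟨j, hj, hx⟩ | hx <;> split_ifs <;> omega
  rcases this with h | ⟨h, h'⟩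
  · rw [h]
  · rw [h, h', ZMod.natCast_self, Nat.cast_zero]

theorem circPerm_eq_self (hD : 2 ≤ D) (hN : N = D + 2 * m + e) {x : ℕ} (hx : x < N)
    (hx1 : x ∉ insert D (stepSet D m N)) : circPerm D m N x = x := by
  simp only [stepSet, mem_insert, mem_union, mem_image, mem_range, mem_Ico, not_or, not_exists,
    not_and] at hx1
  have := hx1.2.2.1 ((x - (D - 1)) / 2)
  unfold circPerm
  split_ifs <;> omega

theorem rootSum_circPerm [NeZero N] (hD : 2 ≤ D) (hm : 1 ≤ m) (hN : N = D + 2 * m + e)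
    (h : (e + 1) * N = (e + m + 1) * (e + m + 1 + 1)) :
    rootSum (fun x : ℕ => (circPerm D m N x - x : ZMod N)) (range N) = 0 := by
  have hDf : circPerm D m N D = D - 1 := by
    unfold circPerm
    split_ifs <;> omega
  have hDT : D ∉ stepSet D m N := by
    simp only [stepSet, mem_insert, mem_union, mem_image, mem_range, mem_Ico]
    omega
  refine rootSum_eq_zero_of_subset _ (T := insert D (stepSet D m N)) ?_ ?_ ?_
  · intro x hx
    simp only [stepSet, mem_insert, mem_union, mem_image, mem_range, mem_Ico] at hx ⊢
    omega
  · intro x hx hx1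
    rw [circPerm_eq_self hD hN (mem_range.1 hx) hx1, sub_self]
  · refine rootSum_eq_zero (by omega) _ (stepSize D m) _ (Nat.succ_pos (e + m)) hDT ?_
      (fun x => circPerm_sub hD hm hN) (fun x _ => stepSize_pos hD x) (sum_stepSize hD hN)
      (card_stepSet hD hN) (by rw [card_stepSize_eq_one hD hm hN, h])
    rw [hDf, Nat.cast_sub (by omega)]
    simp

theorem exists_perm_rootSum_eq_zero [NeZero N] (hD : 2 ≤ D) (hm : 1 ≤ m) (hN : N = D + 2 * m + e)
    (h : (e + 1) * N = (e + m + 1) * (e + m + 1 + 1)) :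
    ∃ σ : Equiv.Perm (ZMod N), rootSum (fun i => σ i - i) univ = 0 := by
  have hinj : Function.Injective fun i : ZMod N => (circPerm D m N i.val : ZMod N) := by
    intro i j hij
    have := congrArg ZMod.val hij
    simp only [ZMod.val_cast_of_lt (circPerm_lt hD hm hN (ZMod.val_lt _))] at this
    exact ZMod.val_injective N (circPerm_injOn hD hm hN (ZMod.val_lt _) (ZMod.val_lt _) this)
  refine ⟨.ofBijective _ (Finite.injective_iff_bijective.1 hinj), ?_⟩
  have hmap : (univ : Finset (ZMod N)).map ⟨ZMod.val, ZMod.val_injective N⟩ = range N := by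
    ext x
    simp only [mem_map, mem_univ, true_and, Function.Embedding.coeFn_mk, mem_range]
    exact ⟨fun ⟨i, hi⟩ => hi ▸ ZMod.val_lt i, fun hx => ⟨x, ZMod.val_cast_of_lt hx⟩⟩
  have h0 := rootSum_circPerm hD hm hN h
  rw [← hmap, rootSum, injSum_map] at h0
  simpa [rootSum] using h0

/-- For coprime `u, v > 1` with `N = u * v`, take `k` divisible by `u` and congruent to `-1` modulo `v`. -/
theorem exists_dvd_mul_succ {N : ℕ} (hN : 1 ≤ N) (h : ¬∃ p r : ℕ, p.Prime ∧ N = p ^ r) :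
    ∃ k, 0 < k ∧ k + 1 < N ∧ N ∣ k * (k + 1) := by
  have hN1 : N ≠ 1 := fun h1 => h ⟨2, 0, Nat.prime_two, by simpa using h1⟩
  have hp := Nat.minFac_prime hN1
  obtain ⟨r, v, hv, hNv⟩ := Nat.exists_eq_pow_mul_and_not_dvd (n := N) (by omega) N.minFac hp.ne_one
  have hr : r ≠ 0 := by
    rintro rfl
    rw [pow_zero, one_mul] at hNv
    exact hv (hNv ▸ N.minFac_dvd)
  generalize N.minFac = p at *
  have hv0 : v ≠ 0 := by rintro rfl; simp at hv
  have hv1 : v ≠ 1 := by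
    rintro rfl
    exact h ⟨p, r, hp, by simpa using hNv⟩
  have hu1 : p ^ r ≠ 1 := (Nat.one_lt_pow hr hp.one_lt).ne'
  have hco : Nat.Coprime (p ^ r) v := Nat.Coprime.pow_left r ((Nat.Prime.coprime_iff_not_dvd hp).2 hv)
  generalize p ^ r = u at *
  subst hNv
  have hu0 : u ≠ 0 := by rintro rfl; simp at hN
  have hlt := Nat.chineseRemainder_lt_mul hco 0 (v - 1) hu0 hv0
  obtain ⟨hku, hkv⟩ := (Nat.chineseRemainder hco 0 (v - 1)).2
  generalize (Nat.chineseRemainder hco 0 (v - 1) : ℕ) = k at *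
  have huk : u ∣ k := (Nat.modEq_zero_iff_dvd).1 hku
  have hvk : v ∣ k + 1 := by
    rw [← Nat.modEq_zero_iff_dvd]
    refine (hkv.add_right 1).trans ?_
    rw [Nat.sub_add_cancel (by omega)]
    simp [Nat.ModEq]
  refine ⟨k, ?_, ?_, mul_dvd_mul huk hvk⟩
  · rw [Nat.pos_iff_ne_zero]
    rintro rfl
    exact hv1 (Nat.dvd_one.1 hvk)
  · refine lt_of_le_of_ne hlt fun hk => hu1 ?_
    rw [← Nat.dvd_one, ← Nat.dvd_add_right huk, hk]
    exact dvd_mul_right u v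

/-- The parameters of `circPerm`: for `k * (k + 1) = q * N` there are `q = e + 1` steps equal to `1`, and
`m = k - q` steps equal to `2`; the remaining step `D` is determined by the total `N + 1`. -/
theorem exists_decomposition {N : ℕ} (hN : 1 ≤ N) (h : ¬∃ p r : ℕ, p.Prime ∧ N = p ^ r) :
    ∃ D m e : ℕ, 2 ≤ D ∧ 1 ≤ m ∧ N = D + 2 * m + e ∧
      (e + 1) * N = (e + m + 1) * (e + m + 1 + 1) := by
  obtain ⟨k, hk0, hkN, q, hq⟩ := exists_dvd_mul_succ hN h
  have hq0 : 1 ≤ q := Nat.one_le_iff_ne_zero.2 (by rintro rfl; simp at hq; omega)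
  have hqk : q < k := by nlinarith
  -- Multiplied by `N`, this is `0 < (N - k) ^ 2 + k`.
  have hD : 2 * k < N + q := by nlinarith [sq_nonneg ((N : ℤ) - k)]
  refine ⟨N + q + 1 - 2 * k, k - q, q - 1, by omega, by omega, by omega, ?_⟩
  rw [show q - 1 + 1 = q by omega, show q - 1 + (k - q) + 1 = k by omega, hq, mul_comm]

end NonPrimePower

theorem theorem3p4 {R : Type*} [CommRing R] [CharZero R] (N : ℕ) (hN : 1 ≤ N) :
    numDetTerms R N = numPermTerms R N ↔ ∃ p r : ℕ, p.Prime ∧ N = p ^ r := by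
  have : NeZero N := ⟨by omega⟩
  have key : numDetTerms R N = numPermTerms R N ↔
      ∀ σ : Equiv.Perm (ZMod N), rootSum (fun i => σ i - i) univ ≠ 0 := by
    rw [← card_support_det_eq_iff R N]
    obtain ⟨n, rfl⟩ := Nat.exists_eq_succ_of_ne_zero (NeZero.ne N)
    rfl
  rw [key]
  constructor
  · intro h
    by_contra hpow
    obtain ⟨D, m, e, hD, hm, hNe, heq⟩ := exists_decomposition hN hpow
    obtain ⟨σ, hσ⟩ := exists_perm_rootSum_eq_zero hD hm hNe heq
    exact h σ hσ
  · rintro ⟨p, r, hp, hNp⟩ σ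
    have := Fact.mk hp
    refine rootSum_ne_zero hNp _ _ (by rw [card_univ, ZMod.card]) ?_
    rw [sum_sub_distrib, Equiv.sum_comp σ fun i => i, sub_self]
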